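/- Let $M:[0,\infty)\to[0,\infty)$ be a convex function with $M(0)=0$, $M(t)>0$ for all $t>0$, $\lim_{t\to 0}M(t)/t=0$ and $\lim_{t\to\infty}t/M(t)=0$. Let $m$ be Lebesgue measure on $(0,1)$, and let $L_M$ be the Orlicz space on $(0,1)$: the space of (classes modulo $m$-a.e. equality of) measurable $x:(0,1)\to\mathbb R$ for which there is $\lambda>0$ with $\int_0^1M(|x(t)|/\lambda)\,dt\le1$, with the norm $$\|x\|_{L_M}=\inf\Big\{\lambda>0:\ \int_0^1M(|x(t)|/\lambda)\,dt\le1\Big\}.$$ For measurable $x$ on $(0,1)$ put $x^*(t)=\inf\{s\ge0:\ m(\{|x|\ge s\})\le t\}$ for $t\ge 0$, and write $y\prec\prec x$ if $\int_0^ty^*(s)\,ds\le\int_0^tx^*(s)\,ds$ for all $t\ge0$. A functional $f\in L_M^*$ is *positive* if $f(x)\ge0$ for all $0\le x\in L_M$. A positive functional $f\in L_M^*$ is *symmetric* (respectively, *fully symmetric*) if $f(y)=f(x)$ (respectively, $f(y)\le f(x)$) for all $0\le x,y\in L_M$ with $y^*=x^*$ (respectively, $y\prec\prec x$). A functional $g\in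 L_M^*$ is *normal* (order continuous) if $g(u_n)\to0$ for every sequence $(u_n)$ in $L_M$ that decreases to $0$ a.e.; a positive $f\in L_M^*$ is *singular* if the only positive normal functional $g\in L_M^*$ such that $f-g$ is positive is $g=0$ (that is, $f$ is disjoint from all normal functionals). Then: 1. every symmetric functional on $L_M$ is fully symmetric; 2. every singular symmetric functional on $L_M$ is zero. -/

import Mathlib

open MeasureTheory Set Filter Topology
open scoped ENNReal

noncomputable section

/-- Lebesgue measure on the interval `(0,1)`. -/
abbrev unitMeasure : Measure ℝ := volume.restrict (Ioo (0 : ℝ) 1)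

/-- The space `L₀(0,1)` of real measurable functions on `(0,1)`, modulo equality almost everywhere. -/
abbrev L0 : Type := ℝ →ₘ[unitMeasure] ℝ

/-- The decreasing right-continuous rearrangement
`x*(t) = inf {s ≥ 0 : m {|x| ≥ s} ≤ t}`, with values in `[0,∞]`
(it is finite for `t > 0`, and `x*(0)` is the essential supremum of `|x|`). -/
def rearrangement (x : L0) (t : ℝ) : ℝ≥0∞ :=
  sInf {s : ℝ≥0∞ | unitMeasure {ω | s ≤ ‖x ω‖ₑ} ≤ ENNReal.ofReal t}

/-- `x* = y*`. -/
def Equimeasurable (x y : L0) : Prop :=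
  ∀ t : ℝ, 0 ≤ t → rearrangement x t = rearrangement y t

/-- `y ≺≺ x`: submajorization in the sense of Hardy, Littlewood and Pólya. -/
def Submajorized (y x : L0) : Prop :=
  ∀ t : ℝ, 0 ≤ t →
    ∫⁻ s in Ioc 0 t, rearrangement y s ≤ ∫⁻ s in Ioc 0 t, rearrangement x s

/-- The conditions on the function `M` on `[0,∞)` that defines an Orlicz space
(only the values of `M` on `[0,∞)` matter). -/
structure IsOrliczFunction (M : ℝ → ℝ) : Prop where
  convexOn : ConvexOn ℝ (Ici 0) M
  map_zero : M 0 = 0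
  pos : ∀ t, 0 < t → 0 < M t
  tendsto_zero : Tendsto (fun t => M t / t) (𝓝[>] 0) (𝓝 0)
  tendsto_top : Tendsto (fun t => t / M t) atTop (𝓝 0)

/-- The modular `∫₀¹ M(|x(t)|/lam) dt`. -/
def orliczModular (M : ℝ → ℝ) (x : L0) (lam : ℝ) : ℝ≥0∞ :=
  ∫⁻ t, ENNReal.ofReal (M (|x t| / lam)) ∂unitMeasure

/-- The set of all `lam > 0` such that `∫₀¹ M(|x(t)|/lam) dt ≤ 1`. -/
def luxemburgSet (M : ℝ → ℝ) (x : L0) : Set ℝ :=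
  {lam : ℝ | 0 < lam ∧ orliczModular M x lam ≤ 1}

/-- The Luxemburg norm `inf {lam > 0 : ∫₀¹ M(|x(t)|/lam) dt ≤ 1}`. -/
def luxemburgNorm (M : ℝ → ℝ) (x : L0) : ℝ := sInf (luxemburgSet M x)

namespace IsOrliczFunction

variable {M : ℝ → ℝ}

theorem nonneg (hM : IsOrliczFunction M) {t : ℝ} (ht : 0 ≤ t) : 0 ≤ M t := by
  rcases ht.eq_or_lt with rfl | h
  · exact hM.map_zero.ge
  · exact (hM.pos t h).le

theorem map_mul_le (hM : IsOrliczFunction M) {c t : ℝ} (hc0 : 0 ≤ c) (hc1 : c ≤ 1)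
    (ht : 0 ≤ t) : M (c * t) ≤ c * M t := by
  have := hM.convexOn.2 (mem_Ici.2 ht) (mem_Ici.2 le_rfl) hc0 (sub_nonneg.2 hc1) (by ring)
  simpa [hM.map_zero] using this

theorem mono (hM : IsOrliczFunction M) {s t : ℝ} (hs : 0 ≤ s) (hst : s ≤ t) : M s ≤ M t := by
  rcases (hs.trans hst).eq_or_lt with h | ht
  · have : s = t := by linarith
    rw [this]
  · have h1 : s / t ≤ 1 := (div_le_one ht).2 hst
    have h := hM.map_mul_le (div_nonneg hs ht.le) h1 ht.le
    rw [div_mul_cancel₀ _ ht.ne'] at h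
    exact h.trans (mul_le_of_le_one_left (hM.nonneg ht.le) h1)

theorem aemeasurable (hM : IsOrliczFunction M) (x : L0) {lam : ℝ} (hl : 0 < lam) :
    AEMeasurable (fun t => ENNReal.ofReal (M (|x t| / lam))) unitMeasure := by
  have hmono : Monotone fun t : ℝ => M (max t 0) := fun a b hab =>
    hM.mono (le_max_right _ _) (max_le_max hab le_rfl)
  have hx : Measurable fun t => |x t| / lam := (x.measurable.abs).div_const lam
  have h := (hmono.measurable.comp hx).ennreal_ofReal.aemeasurable (μ := unitMeasure)
  refine h.congr (Eventually.of_forall fun t => ?_)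
  have : 0 ≤ |x t| / lam := by positivity
  simp [Function.comp, max_eq_left this]

theorem modular_zero (hM : IsOrliczFunction M) (lam : ℝ) : orliczModular M 0 lam = 0 := by
  unfold orliczModular
  rw [← lintegral_zero (μ := unitMeasure)]
  refine lintegral_congr_ae ?_
  filter_upwards [AEEqFun.coeFn_zero (α := ℝ) (β := ℝ) (μ := unitMeasure)] with t ht
  simp [ht, hM.map_zero]

theorem modular_smul (c lam : ℝ) (x : L0) (hc : c ≠ 0) :
    orliczModular M (c • x) (|c| * lam) = orliczModular M x lam := by
  unfold orliczModular
  refine lintegral_congr_ae ?_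
  filter_upwards [AEEqFun.coeFn_smul c x] with t ht
  have : |c| ≠ 0 := abs_ne_zero.2 hc
  rw [ht, Pi.smul_apply, smul_eq_mul, abs_mul, mul_div_mul_left _ _ this]

theorem add_mem (hM : IsOrliczFunction M) {x y : L0} {a b : ℝ} (ha : a ∈ luxemburgSet M x)
    (hb : b ∈ luxemburgSet M y) : a + b ∈ luxemburgSet M (x + y) := by
  obtain ⟨ha0, ha⟩ := ha
  obtain ⟨hb0, hb⟩ := hb
  have hab : 0 < a + b := add_pos ha0 hb0
  refine ⟨hab, ?_⟩
  set p := a / (a + b) with hp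
  set q := b / (a + b) with hq
  have hp0 : 0 ≤ p := by positivity
  have hq0 : 0 ≤ q := by positivity
  have hpq : p + q = 1 := by rw [hp, hq]; field_simp
  calc orliczModular M (x + y) (a + b)
      ≤ ∫⁻ t, (ENNReal.ofReal p * ENNReal.ofReal (M (|x t| / a))
          + ENNReal.ofReal q * ENNReal.ofReal (M (|y t| / b))) ∂unitMeasure := by
        refine lintegral_mono_ae ?_
        filter_upwards [AEEqFun.coeFn_add x y] with t ht
        have hxa : 0 ≤ |x t| / a := by positivity
        have hyb : 0 ≤ |y t| / b := by positivity
        have h1 : M (|(x + y) t| / (a + b)) ≤ M (p * (|x t| / a) + q * (|y t| / b)) := by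
          refine hM.mono (by positivity) ?_
          have : p * (|x t| / a) + q * (|y t| / b) = (|x t| + |y t|) / (a + b) := by
            rw [hp, hq]; field_simp
          rw [this, ht]
          exact div_le_div_of_nonneg_right (abs_add_le _ _) hab.le
        have h2 := hM.convexOn.2 (mem_Ici.2 hxa) (mem_Ici.2 hyb) hp0 hq0 hpq
        simp only [smul_eq_mul] at h2
        rw [← ENNReal.ofReal_mul hp0, ← ENNReal.ofReal_mul hq0,
          ← ENNReal.ofReal_add (mul_nonneg hp0 (hM.nonneg hxa)) (mul_nonneg hq0 (hM.nonneg hyb))]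
        exact ENNReal.ofReal_le_ofReal (h1.trans h2)
    _ = ENNReal.ofReal p * orliczModular M x a + ENNReal.ofReal q * orliczModular M y b := by
        rw [lintegral_add_left' ((hM.aemeasurable x ha0).const_mul _),
          lintegral_const_mul'' _ (hM.aemeasurable x ha0),
          lintegral_const_mul'' _ (hM.aemeasurable y hb0)]
        rfl
    _ ≤ ENNReal.ofReal p * 1 + ENNReal.ofReal q * 1 := by gcongr
    _ = 1 := by
        rw [mul_one, mul_one, ← ENNReal.ofReal_add hp0 hq0, hpq, ENNReal.ofReal_one]

theorem zero_mem (hM : IsOrliczFunction M) {lam : ℝ} (hl : 0 < lam) :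
    lam ∈ luxemburgSet M 0 :=
  ⟨hl, by rw [hM.modular_zero]; exact zero_le_one⟩

theorem smul_mem {x : L0} {c lam : ℝ} (hc : c ≠ 0) (h : lam ∈ luxemburgSet M x) :
    |c| * lam ∈ luxemburgSet M (c • x) :=
  ⟨mul_pos (abs_pos.2 hc) h.1, by rw [modular_smul c lam x hc]; exact h.2⟩

end IsOrliczFunction

theorem luxemburgSet_bddBelow (M : ℝ → ℝ) (x : L0) : BddBelow (luxemburgSet M x) :=
  ⟨0, fun _ h => h.1.le⟩

theorem luxemburgNorm_nonneg (M : ℝ → ℝ) (x : L0) : 0 ≤ luxemburgNorm M x :=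
  Real.sInf_nonneg fun _ h => h.1.le

/-- The Orlicz space `L_M` on `(0,1)`: all `x` for which the infimum defining the Luxemburg norm
is finite, that is, taken over a non-empty set. -/
def orliczSpace {M : ℝ → ℝ} (hM : IsOrliczFunction M) : Submodule ℝ L0 where
  carrier := {x | (luxemburgSet M x).Nonempty}
  zero_mem' := ⟨1, hM.zero_mem one_pos⟩
  add_mem' := by
    rintro x y ⟨a, ha⟩ ⟨b, hb⟩
    exact ⟨a + b, hM.add_mem ha hb⟩
  smul_mem' := by
    rintro c x ⟨a, ha⟩
    rcases eq_or_ne c 0 with rfl | hc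
    · rw [zero_smul]
      exact ⟨1, hM.zero_mem one_pos⟩
    · exact ⟨|c| * a, IsOrliczFunction.smul_mem hc ha⟩

section Norm

variable {M : ℝ → ℝ}

theorem luxemburgNorm_zero (hM : IsOrliczFunction M) : luxemburgNorm M 0 = 0 := by
  refine le_antisymm (le_of_forall_pos_le_add fun ε hε => ?_) (luxemburgNorm_nonneg M 0)
  rw [zero_add]
  exact csInf_le (luxemburgSet_bddBelow M 0) (hM.zero_mem hε)

theorem luxemburgNorm_smul_le (hM : IsOrliczFunction M) (c : ℝ) {x : L0}
    (hx : (luxemburgSet M x).Nonempty) :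
    luxemburgNorm M (c • x) ≤ |c| * luxemburgNorm M x := by
  rcases eq_or_ne c 0 with rfl | hc
  · rw [zero_smul, luxemburgNorm_zero hM, abs_zero, zero_mul]
  · have hc' : 0 < |c| := abs_pos.2 hc
    rw [← div_le_iff₀' hc']
    refine le_csInf hx fun a ha => ?_
    rw [div_le_iff₀' hc']
    exact csInf_le (luxemburgSet_bddBelow M _) (IsOrliczFunction.smul_mem hc ha)

theorem luxemburgNorm_smul (hM : IsOrliczFunction M) (c : ℝ) {x : L0}
    (hx : (luxemburgSet M x).Nonempty) :
    luxemburgNorm M (c • x) = |c| * luxemburgNorm M x := by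
  refine le_antisymm (luxemburgNorm_smul_le hM c hx) ?_
  rcases eq_or_ne c 0 with rfl | hc
  · rw [abs_zero, zero_mul]
    exact luxemburgNorm_nonneg M _
  · have h := luxemburgNorm_smul_le hM c⁻¹ ((orliczSpace hM).smul_mem c hx)
    rw [smul_smul, inv_mul_cancel₀ hc, one_smul, abs_inv, ← div_eq_inv_mul,
      le_div_iff₀' (abs_pos.2 hc)] at h
    exact h

theorem luxemburgNorm_add_le (hM : IsOrliczFunction M) {x y : L0}
    (hx : (luxemburgSet M x).Nonempty) (hy : (luxemburgSet M y).Nonempty) :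
    luxemburgNorm M (x + y) ≤ luxemburgNorm M x + luxemburgNorm M y := by
  have key : ∀ a ∈ luxemburgSet M x, ∀ b ∈ luxemburgSet M y,
      luxemburgNorm M (x + y) ≤ a + b := fun a ha b hb =>
    csInf_le (luxemburgSet_bddBelow M _) (hM.add_mem ha hb)
  have h1 : ∀ a ∈ luxemburgSet M x, luxemburgNorm M (x + y) - a ≤ luxemburgNorm M y :=
    fun a ha => le_csInf hy fun b hb => by linarith [key a ha b hb]
  have h2 : luxemburgNorm M (x + y) - luxemburgNorm M y ≤ luxemburgNorm M x :=
    le_csInf hx fun a ha => by linarith [h1 a ha]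
  linarith

theorem eq_zero_of_luxemburgNorm_eq_zero (hM : IsOrliczFunction M) {x : L0}
    (hx : (luxemburgSet M x).Nonempty) (h0 : luxemburgNorm M x = 0) : x = 0 := by
  have hle : ∀ ε : ℝ, 0 < ε → orliczModular M x 1 ≤ ENNReal.ofReal ε := by
    intro ε hε
    obtain ⟨a, ha, hlt⟩ := exists_lt_of_csInf_lt hx
      (show sInf (luxemburgSet M x) < min ε 1 by
        have : sInf (luxemburgSet M x) = 0 := h0
        rw [this]; exact lt_min hε one_pos)
    have ha1 : a ≤ 1 := (hlt.trans_le (min_le_right _ _)).le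
    have haε : a ≤ ε := (hlt.trans_le (min_le_left _ _)).le
    calc orliczModular M x 1
        ≤ ∫⁻ t, ENNReal.ofReal a * ENNReal.ofReal (M (|x t| / a)) ∂unitMeasure := by
          refine lintegral_mono fun t => ?_
          have hxa : 0 ≤ |x t| / a := div_nonneg (abs_nonneg _) ha.1.le
          have := hM.map_mul_le ha.1.le ha1 hxa
          rw [mul_div_cancel₀ _ ha.1.ne'] at this
          rw [← ENNReal.ofReal_mul ha.1.le, div_one]
          exact ENNReal.ofReal_le_ofReal this
      _ = ENNReal.ofReal a * orliczModular M x a :=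
          lintegral_const_mul'' _ (hM.aemeasurable x ha.1)
      _ ≤ ENNReal.ofReal ε * 1 := by gcongr; exact ha.2
      _ = ENNReal.ofReal ε := mul_one _
  have hz : orliczModular M x 1 = 0 := by
    refine le_antisymm (ENNReal.le_of_forall_pos_le_add fun ε hε _ => ?_) zero_le
    rw [zero_add]
    simpa using hle ε (by exact_mod_cast hε)
  have hae := (lintegral_eq_zero_iff' (hM.aemeasurable x one_pos)).1 hz
  refine AEEqFun.ext ?_
  filter_upwards [hae, AEEqFun.coeFn_zero (α := ℝ) (β := ℝ) (μ := unitMeasure)] with t ht ht0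
  rw [ht0]
  by_contra hne
  have hpos : 0 < |x t| / 1 := by rw [div_one]; exact abs_pos.2 hne
  exact absurd ht (ENNReal.ofReal_pos.2 (hM.pos _ hpos)).ne'

instance (hM : IsOrliczFunction M) : Norm (orliczSpace hM) := ⟨fun x => luxemburgNorm M x⟩

theorem orliczSpace_core (hM : IsOrliczFunction M) : NormedSpace.Core ℝ (orliczSpace hM) where
  norm_nonneg x := luxemburgNorm_nonneg M x
  norm_smul c x := luxemburgNorm_smul hM c x.2
  norm_triangle x y := luxemburgNorm_add_le hM x.2 y.2
  norm_eq_zero_iff x :=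
    ⟨fun h => Subtype.ext (eq_zero_of_luxemburgNorm_eq_zero hM x.2 h),
      fun h => by rw [h]; exact luxemburgNorm_zero hM⟩

/-- `L_M` with the Luxemburg norm. -/
instance (hM : IsOrliczFunction M) : NormedAddCommGroup (orliczSpace hM) :=
  NormedAddCommGroup.ofCore (orliczSpace_core hM)

instance (hM : IsOrliczFunction M) : NormedSpace ℝ (orliczSpace hM) :=
  NormedSpace.ofCore (orliczSpace_core hM)

end Norm

section Functionals

variable {M : ℝ → ℝ} {hM : IsOrliczFunction M}

/-- `f x ≥ 0` for all `x ≥ 0`. -/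
def IsPositiveFunctional (f : StrongDual ℝ (orliczSpace hM)) : Prop :=
  ∀ x : orliczSpace hM, 0 ≤ (x : L0) → 0 ≤ f x

/-- A positive functional `f` in the dual of `L_M` is symmetric if `f x = f y` for all
`0 ≤ x, y ∈ L_M` such that `y* = x*`. -/
def IsSymmetricFunctional (f : StrongDual ℝ (orliczSpace hM)) : Prop :=
  IsPositiveFunctional f ∧
    ∀ x y : orliczSpace hM, 0 ≤ (x : L0) → 0 ≤ (y : L0) →
      Equimeasurable (y : L0) (x : L0) → f y = f x

/-- A positive functional `f` in the dual of `L_M` is fully symmetric if `f y ≤ f x` for all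
`0 ≤ x, y ∈ L_M` such that `y ≺≺ x`. -/
def IsFullySymmetricFunctional (f : StrongDual ℝ (orliczSpace hM)) : Prop :=
  IsPositiveFunctional f ∧
    ∀ x y : orliczSpace hM, 0 ≤ (x : L0) → 0 ≤ (y : L0) →
      Submajorized (y : L0) (x : L0) → f y ≤ f x

/-- A functional is normal (order continuous) if `g (u n) → 0` whenever `u n ↓ 0`
almost everywhere. -/
def IsNormalFunctional (g : StrongDual ℝ (orliczSpace hM)) : Prop :=
  ∀ u : ℕ → orliczSpace hM, (Antitone fun n => (u n : L0)) →
    (∀ᵐ t ∂unitMeasure, Tendsto (fun n => (u n : L0) t) atTop (𝓝 0)) →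
      Tendsto (fun n => g (u n)) atTop (𝓝 0)

/-- A positive functional `f` is singular (disjoint from all normal functionals) if the only
normal functional `g` with `0 ≤ g ≤ f` is `0`. -/
def IsSingularFunctional (f : StrongDual ℝ (orliczSpace hM)) : Prop :=
  ∀ g : StrongDual ℝ (orliczSpace hM), IsPositiveFunctional g → IsNormalFunctional g →
    IsPositiveFunctional (f - g) → g = 0

end Functionals

end

/-! Every symmetric functional is a multiple of the integral: `f x = f 1 * ∫ x` for `x ≥ 0`. Both
claims follow, since the integral is normal and fully symmetric.

The decisive point is that dilations grow slowly on `L_M`. Cut `z ≥ 0` to `(0,1/n]` and lay `n`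
translated copies side by side to get `σₙ z`. Convexity gives `M(|z|/(nε)) ≤ (a/(nε)) M(|z|/a)`, so
the modular of `σₙ z` at `nε` is at most `(a/ε) ∫₀^{1/n} M(|z|/a)`, which tends to `0` by absolute
continuity of the integral. Hence `‖σₙ z‖ / n → 0` (`eventually_norm_sum_piece_le`). A symmetric `f`
takes the same value on all copies, so `f` of the head of `z` on `(0,1/n]` equals `f (σₙ z) / n` and
tends to `0` (`tendsto_map_piece`).

Now replace `x` by `x*`, which is decreasing. It lies between a lower staircase and the head plus an
upper staircase with the same heights. Symmetry fixes `f` on a staircase as `f 1` times a Riemann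
sum, so only the vanishing head separates `f x` from it (`tendsto_sub_riemannSum`). The integral has
the same Riemann sums; comparing the two gives `eq_mul_integral`. -/

/-! ### Decreasing rearrangements and distributions. -/

theorem rearrangement_antitone (x : L0) : Antitone (rearrangement x) := fun _ _ hab =>
  sInf_le_sInf fun _ hs => le_trans hs (ENNReal.ofReal_le_ofReal hab)

/-- Continuity of measure along `u n ↓ s` turns the closed level sets of the definition into the
open set `{|x| > s}`, so that the infimum is attained in this form. -/
theorem rearrangement_le_iff (x : L0) (t : ℝ) (s : ℝ≥0∞) :
    rearrangement x t ≤ s ↔ unitMeasure {ω | s < ‖x ω‖ₑ} ≤ ENNReal.ofReal t := by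
  constructor
  · intro h
    rcases eq_or_ne s ⊤ with rfl | hs
    · simp
    have hd : ∀ s' > s, unitMeasure {ω | s' ≤ ‖x ω‖ₑ} ≤ ENNReal.ofReal t := by
      intro s' hs'
      obtain ⟨r, hr, hrs⟩ := sInf_lt_iff.1 (h.trans_lt hs')
      exact (measure_mono fun ω hω => hrs.le.trans hω).trans hr
    obtain ⟨u, hu, hus, hut⟩ := exists_seq_strictAnti_tendsto' (lt_top_iff_ne_top.2 hs)
    have hset : {ω | s < ‖x ω‖ₑ} = ⋃ n, {ω | u n ≤ ‖x ω‖ₑ} := by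
      ext ω
      simp only [mem_ofPred_eq, mem_iUnion]
      constructor
      · intro hω
        obtain ⟨n, hn⟩ := (hut.eventually (gt_mem_nhds hω)).exists
        exact ⟨n, hn.le⟩
      · rintro ⟨n, hn⟩
        exact (hus n).1.trans_le hn
    rw [hset, Monotone.measure_iUnion]
    · exact iSup_le fun n => hd _ (hus n).1
    · exact fun a b hab ω hω => (hu.antitone hab).trans hω
  · intro h
    refine le_of_forall_gt_imp_ge_of_dense fun s' hs' => sInf_le ?_
    exact (measure_mono fun ω hω => hs'.trans_le hω).trans h

/-- The sets `{|x| > n}` decrease to the empty set inside a finite measure space, so some tail has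
measure below `t`. -/
theorem rearrangement_lt_top (x : L0) {t : ℝ} (ht : 0 < t) : rearrangement x t < ⊤ := by
  have hlim : Tendsto (fun n : ℕ => unitMeasure {ω | (n : ℝ≥0∞) < ‖x ω‖ₑ}) atTop (𝓝 0) := by
    have hm : ∀ n : ℕ, MeasurableSet {ω | (n : ℝ≥0∞) < ‖x ω‖ₑ} := fun n =>
      measurableSet_lt measurable_const x.measurable.enorm
    have := tendsto_measure_iInter_atTop (μ := unitMeasure)
      (s := fun n : ℕ => {ω | (n : ℝ≥0∞) < ‖x ω‖ₑ}) (fun n => (hm n).nullMeasurableSet)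
      (fun a b hab ω (hω : (b : ℝ≥0∞) < _) =>
        show (a : ℝ≥0∞) < _ from lt_of_le_of_lt (by exact_mod_cast hab) hω) ⟨0, measure_ne_top _ _⟩
    have he : ⋂ n : ℕ, {ω | (n : ℝ≥0∞) < ‖x ω‖ₑ} = ∅ := by
      refine eq_empty_of_forall_notMem fun ω hω => ?_
      obtain ⟨n, hn⟩ := ENNReal.exists_nat_gt (enorm_ne_top (x := x ω))
      exact lt_asymm hn (mem_iInter.1 hω n)
    rwa [he, measure_empty] at this
  obtain ⟨n, hn⟩ := (hlim.eventually (gt_mem_nhds (ENNReal.ofReal_pos.2 ht))).exists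
  exact ((rearrangement_le_iff x t n).2 hn.le).trans_lt (ENNReal.natCast_lt_top n)

theorem map_rearrangement (x : L0) :
    unitMeasure.map (rearrangement x) = unitMeasure.map fun t => ‖x t‖ₑ := by
  have hR := (rearrangement_antitone x).measurable
  have hx : Measurable fun t => ‖x t‖ₑ := x.measurable.enorm
  have : IsProbabilityMeasure unitMeasure := ⟨by simp⟩
  refine Measure.ext_of_Iic _ _ fun s => ?_
  rw [Measure.map_apply hR measurableSet_Iic, Measure.map_apply hx measurableSet_Iic]
  set p : ℝ := unitMeasure.real {ω | s < ‖x ω‖ₑ} with hp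
  have hp0 : 0 ≤ p := measureReal_nonneg
  have hp1 : p ≤ 1 := measureReal_le_one
  have hpe : unitMeasure {ω | s < ‖x ω‖ₑ} = ENNReal.ofReal p := by
    rw [hp, ofReal_measureReal]
  have h1 : (fun t => ‖x t‖ₑ) ⁻¹' Iic s = {ω | s < ‖x ω‖ₑ}ᶜ := by
    ext ω; simp
  rw [h1, prob_compl_eq_one_sub (measurableSet_lt measurable_const hx), hpe,
    Measure.restrict_apply (hR measurableSet_Iic)]
  -- By `rearrangement_le_iff`, `x* t ≤ s` on `(0,1)` means `p ≤ t`; only the endpoint `p` needs a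
  -- null-set argument.
  have h2 : (rearrangement x ⁻¹' Iic s ∩ Ioo 0 1 : Set ℝ) =ᵐ[volume] (Ico p 1 : Set ℝ) := by
    have h3 : (Ico p 1 : Set ℝ) =ᵐ[volume] (Ioo p 1 : Set ℝ) := Ioo_ae_eq_Ico.symm
    refine (ae_eq_set.2 ⟨?_, ?_⟩).trans h3.symm
    · refine measure_mono_null (t := {p}) ?_ (by simp)
      rintro t ⟨⟨ht, ht0, ht1⟩, hn⟩
      rw [mem_preimage, mem_Iic, rearrangement_le_iff, hpe, ENNReal.ofReal_le_ofReal_iff ht0.le] at ht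
      exact (ht.eq_or_lt.resolve_right fun h => hn ⟨h, ht1⟩).symm
    · refine measure_mono_null (t := ∅) ?_ (by simp)
      rintro t ⟨⟨htp, ht1⟩, hn⟩
      refine hn ⟨?_, hp0.trans_lt htp, ht1⟩
      rw [mem_preimage, mem_Iic, rearrangement_le_iff, hpe]
      exact ENNReal.ofReal_le_ofReal htp.le
  rw [measure_congr h2, Real.volume_Ico, ENNReal.ofReal_sub _ hp0, ENNReal.ofReal_one]

theorem lintegral_rearrangement (x : L0) :
    ∫⁻ s in Ioc 0 1, rearrangement x s = ∫⁻ t, ‖x t‖ₑ ∂unitMeasure := by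
  rw [← restrict_Ioo_eq_restrict_Ioc]
  have h1 := lintegral_map (μ := unitMeasure) measurable_id (rearrangement_antitone x).measurable
  rw [map_rearrangement, lintegral_map measurable_id x.measurable.enorm] at h1
  exact h1.symm

/-- `x` and `y` have the same distribution away from the value `0`. -/
def SameLaw (x y : L0) : Prop :=
  ∀ F : ℝ → ℝ≥0∞, Measurable F → F 0 = 0 →
    ∫⁻ t, F (x t) ∂unitMeasure = ∫⁻ t, F (y t) ∂unitMeasure

theorem SameLaw.equimeasurable {x y : L0} (h : SameLaw x y) : Equimeasurable x y := by
  intro t _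
  unfold rearrangement
  congr 1
  ext s
  suffices unitMeasure {ω | s ≤ ‖x ω‖ₑ} = unitMeasure {ω | s ≤ ‖y ω‖ₑ} by
    rw [mem_ofPred_eq, mem_ofPred_eq, this]
  -- For `s = 0` both level sets are everything; otherwise the indicator of `{s ≤ |a|}` vanishes at
  -- `0` and is an admissible test function.
  rcases eq_or_ne s 0 with rfl | hs
  · simp
  have hm : MeasurableSet {a : ℝ | s ≤ ‖a‖ₑ} := measurableSet_le measurable_const measurable_enorm
  have := h ({a : ℝ | s ≤ ‖a‖ₑ}.indicator 1) (measurable_one.indicator hm) (by simp [hs])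
  have key : ∀ z : L0, ∫⁻ t, {a : ℝ | s ≤ ‖a‖ₑ}.indicator 1 (z t) ∂unitMeasure
      = unitMeasure {ω | s ≤ ‖z ω‖ₑ} := fun z =>
    (lintegral_indicator_one (z.measurable hm))
  rwa [key, key] at this

/-- The decreasing rearrangement as a real function. -/
noncomputable def realRearrangement (x : L0) (t : ℝ) : ℝ := (rearrangement x t).toReal

theorem realRearrangement_nonneg (x : L0) (t : ℝ) : 0 ≤ realRearrangement x t :=
  ENNReal.toReal_nonneg

theorem measurable_realRearrangement (x : L0) : Measurable (realRearrangement x) :=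
  (rearrangement_antitone x).measurable.ennreal_toReal

/-- The point `0` is excluded because `x*` may be `⊤` there, which `toReal` sends to `0`. -/
theorem realRearrangement_antitoneOn (x : L0) : AntitoneOn (realRearrangement x) (Ioi 0) :=
  fun _ ha _ _ hab =>
    ENNReal.toReal_mono (rearrangement_lt_top x ha).ne (rearrangement_antitone x hab)

theorem sameLaw_realRearrangement {x : L0} (hx : 0 ≤ x) :
    SameLaw (AEEqFun.mk (realRearrangement x)
      (measurable_realRearrangement x).aestronglyMeasurable) x := by
  intro F hF _
  have hG : Measurable fun s : ℝ≥0∞ => F s.toReal := hF.comp ENNReal.measurable_toReal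
  calc ∫⁻ t, F (AEEqFun.mk (realRearrangement x)
        (measurable_realRearrangement x).aestronglyMeasurable t) ∂unitMeasure
      = ∫⁻ t, F (rearrangement x t).toReal ∂unitMeasure := by
        refine lintegral_congr_ae ?_
        filter_upwards [AEEqFun.coeFn_mk (μ := unitMeasure) (realRearrangement x)
          (measurable_realRearrangement x).aestronglyMeasurable] with t ht
        rw [ht]; rfl
    _ = ∫⁻ t, F (‖x t‖ₑ).toReal ∂unitMeasure := by
        rw [← lintegral_map hG (rearrangement_antitone x).measurable, map_rearrangement,
          lintegral_map hG x.measurable.enorm]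
    _ = ∫⁻ t, F (x t) ∂unitMeasure := by
        refine lintegral_congr_ae ?_
        filter_upwards [AEEqFun.coeFn_le.2 hx,
          AEEqFun.coeFn_zero (α := ℝ) (β := ℝ) (μ := unitMeasure)] with t ht h0
        rw [h0] at ht
        simp only [toReal_enorm, Real.norm_of_nonneg (show 0 ≤ x t from ht)]
-- Membership in `L_M` and the embedding into `L₁`.
section OrliczBounds

variable {M : ℝ → ℝ}

theorem IsOrliczFunction.measurable_modular (hM : IsOrliczFunction M) {lam : ℝ} (hl : 0 < lam) :
    Measurable fun s : ℝ => ENNReal.ofReal (M (|s| / lam)) := by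
  have hmono : Monotone fun t : ℝ => M (max t 0) := fun a b hab =>
    hM.mono (le_max_right _ _) (max_le_max hab le_rfl)
  have hx : Measurable fun s : ℝ => |s| / lam := measurable_norm.div_const lam
  convert (hmono.measurable.comp hx).ennreal_ofReal using 3 with s
  have : 0 ≤ |s| / lam := by positivity
  simp [Function.comp, max_eq_left this]

theorem luxemburgSet_nonempty_of_abs_le (hM : IsOrliczFunction M) {x y : L0}
    (hx : (luxemburgSet M x).Nonempty) (h : ∀ᵐ t ∂unitMeasure, |y t| ≤ |x t|) :
    (luxemburgSet M y).Nonempty := by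
  obtain ⟨a, ha, ha1⟩ := hx
  refine ⟨a, ha, le_trans (lintegral_mono_ae ?_) ha1⟩
  filter_upwards [h] with t ht
  exact ENNReal.ofReal_le_ofReal (hM.mono (by positivity) (by gcongr))

theorem SameLaw.luxemburgSet_nonempty (hM : IsOrliczFunction M) {x y : L0} (h : SameLaw x y)
    (hy : (luxemburgSet M y).Nonempty) : (luxemburgSet M x).Nonempty := by
  obtain ⟨a, ha, ha1⟩ := hy
  refine ⟨a, ha, le_of_eq_of_le ?_ ha1⟩
  exact h _ (hM.measurable_modular ha) (by simp [hM.map_zero])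

theorem luxemburgSet_one_nonempty (hM : IsOrliczFunction M) :
    (luxemburgSet M (1 : L0)).Nonempty := by
  have h1 : 0 < M 1 := hM.pos 1 one_pos
  -- Convexity gives `M (1 / (1 + M 1)) ≤ M 1 / (1 + M 1) ≤ 1`.
  refine ⟨1 + M 1, by positivity, ?_⟩
  calc orliczModular M 1 (1 + M 1) ≤ ∫⁻ _, 1 ∂unitMeasure := by
        refine lintegral_mono_ae ?_
        filter_upwards [AEEqFun.coeFn_one (α := ℝ) (β := ℝ) (μ := unitMeasure)] with t ht
        rw [ht, Pi.one_apply, abs_one, ENNReal.ofReal_le_one]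
        have := hM.map_mul_le (c := 1 / (1 + M 1)) (t := 1) (by positivity)
          ((div_le_one (by positivity)).2 (by linarith)) zero_le_one
        rw [mul_one] at this
        refine this.trans ?_
        rw [one_div, inv_mul_le_iff₀ (by positivity)]
        linarith
    _ = 1 := by simp

/-- For `t ≥ 1` convexity and `M 0 = 0` give `t * M 1 ≤ M t`; the summand `1` covers `t ≤ 1`.
Applied to `|x| / lam`, this bounds the `L₁` norm by the Luxemburg norm. -/
theorem IsOrliczFunction.le_one_add (hM : IsOrliczFunction M) {t : ℝ} (ht : 0 ≤ t) :
    t ≤ 1 + (M 1)⁻¹ * M t := by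
  have h1 : 0 < M 1 := hM.pos 1 one_pos
  rcases le_total t 1 with h | h
  · have := mul_nonneg (inv_nonneg.2 h1.le) (hM.nonneg ht)
    linarith
  · have h0 : 0 < t := by linarith
    have := hM.map_mul_le (c := t⁻¹) (by positivity) (inv_le_one_of_one_le₀ h) ht
    rw [inv_mul_cancel₀ h0.ne', ← div_eq_inv_mul, le_div_iff₀ h0] at this
    have : t ≤ (M 1)⁻¹ * M t := by
      rw [← div_eq_inv_mul, le_div_iff₀ h1]; linarith
    linarith

theorem lintegral_enorm_le_of_mem_luxemburgSet (hM : IsOrliczFunction M) {x : L0} {lam : ℝ}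
    (h : lam ∈ luxemburgSet M x) :
    ∫⁻ t, ‖x t‖ₑ ∂unitMeasure ≤ ENNReal.ofReal ((1 + (M 1)⁻¹) * lam) := by
  obtain ⟨hl, h1⟩ := h
  have hM1 : 0 < M 1 := hM.pos 1 one_pos
  calc ∫⁻ t, ‖x t‖ₑ ∂unitMeasure
      ≤ ∫⁻ t, (ENNReal.ofReal lam + ENNReal.ofReal (lam * (M 1)⁻¹) *
          ENNReal.ofReal (M (|x t| / lam))) ∂unitMeasure := by
        refine lintegral_mono fun t => ?_
        have hx : 0 ≤ |x t| / lam := by positivity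
        have := hM.le_one_add hx
        rw [div_le_iff₀ hl] at this
        rw [← ENNReal.ofReal_mul (by positivity),
          ← ENNReal.ofReal_add hl.le (mul_nonneg (by positivity) (hM.nonneg hx)),
          ← ofReal_norm, Real.norm_eq_abs]
        refine ENNReal.ofReal_le_ofReal (this.trans_eq ?_)
        ring
    _ = ENNReal.ofReal lam + ENNReal.ofReal (lam * (M 1)⁻¹) * orliczModular M x lam := by
        rw [lintegral_add_left measurable_const, lintegral_const_mul'' _ (hM.aemeasurable x hl)]
        simp [orliczModular]
    _ ≤ ENNReal.ofReal lam + ENNReal.ofReal (lam * (M 1)⁻¹) * 1 := by gcongr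
    _ = ENNReal.ofReal ((1 + (M 1)⁻¹) * lam) := by
        rw [mul_one, ← ENNReal.ofReal_add hl.le (by positivity)]
        congr 1; ring

theorem integrable_of_luxemburgSet_nonempty (hM : IsOrliczFunction M) {x : L0}
    (hx : (luxemburgSet M x).Nonempty) : Integrable x unitMeasure := by
  obtain ⟨a, ha⟩ := hx
  exact ⟨x.aestronglyMeasurable,
    (lintegral_enorm_le_of_mem_luxemburgSet hM ha).trans_lt ENNReal.ofReal_lt_top⟩

/-- The functional `x ↦ ∫₀¹ x(t) dt` on `L_M`. -/
noncomputable def integralFunctional (hM : IsOrliczFunction M) : StrongDual ℝ (orliczSpace hM) :=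
  LinearMap.mkContinuous
    { toFun := fun x => ∫ t, (x : L0) t ∂unitMeasure
      map_add' := fun x y => by
        rw [← integral_add (integrable_of_luxemburgSet_nonempty hM x.2)
          (integrable_of_luxemburgSet_nonempty hM y.2)]
        exact integral_congr_ae (AEEqFun.coeFn_add (x : L0) (y : L0))
      map_smul' := fun c x => by
        rw [RingHom.id_apply, smul_eq_mul, ← integral_const_mul]
        exact integral_congr_ae (AEEqFun.coeFn_smul c (x : L0)) }
    (1 + (M 1)⁻¹) fun x => by
      have hM1 : 0 < M 1 := hM.pos 1 one_pos
      change ‖∫ t, (x : L0) t ∂unitMeasure‖ ≤ (1 + (M 1)⁻¹) * luxemburgNorm M x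
      rw [← div_le_iff₀' (by positivity)]
      refine le_csInf x.2 fun a ha => ?_
      rw [div_le_iff₀' (by positivity)]
      refine (norm_integral_le_lintegral_norm _).trans
        (ENNReal.toReal_le_of_le_ofReal (mul_nonneg (by positivity) ha.1.le) ?_)
      simpa only [ofReal_norm] using lintegral_enorm_le_of_mem_luxemburgSet hM ha

theorem integralFunctional_apply (hM : IsOrliczFunction M) (x : orliczSpace hM) :
    integralFunctional hM x = ∫ t, (x : L0) t ∂unitMeasure := rfl

end OrliczBounds

/-! ### The integral as a normal, fully symmetric functional. -/

section IntegralFunctional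

variable {M : ℝ → ℝ} {hM : IsOrliczFunction M}

theorem L0.ae_nonneg {x : L0} (hx : 0 ≤ x) : ∀ᵐ t ∂unitMeasure, 0 ≤ x t := by
  filter_upwards [AEEqFun.coeFn_le.2 hx,
    AEEqFun.coeFn_zero (α := ℝ) (β := ℝ) (μ := unitMeasure)] with t ht h0
  rwa [h0] at ht

theorem L0.nonneg_of_ae {x : L0} (hx : ∀ᵐ t ∂unitMeasure, 0 ≤ x t) : 0 ≤ x := by
  refine AEEqFun.coeFn_le.1 ?_
  filter_upwards [hx, AEEqFun.coeFn_zero (α := ℝ) (β := ℝ) (μ := unitMeasure)] with t ht h0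
  rwa [h0]

/-- On the positive cone the integral depends on `x*` alone, which makes it symmetric; full symmetry
is then submajorization at `t = 1`. -/
theorem integralFunctional_eq (x : orliczSpace hM) (hx : 0 ≤ (x : L0)) :
    integralFunctional hM x = (∫⁻ s in Ioc 0 1, rearrangement (x : L0) s).toReal := by
  rw [integralFunctional_apply, lintegral_rearrangement,
    integral_eq_lintegral_of_nonneg_ae (L0.ae_nonneg hx) (x : L0).aestronglyMeasurable]
  congr 1
  refine lintegral_congr_ae ?_
  filter_upwards [L0.ae_nonneg hx] with t ht
  rw [← ofReal_norm, Real.norm_of_nonneg ht]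

theorem isPositiveFunctional_integralFunctional :
    IsPositiveFunctional (integralFunctional hM) := fun _ hx =>
  integral_nonneg_of_ae (L0.ae_nonneg hx)

theorem isSymmetricFunctional_integralFunctional :
    IsSymmetricFunctional (integralFunctional hM) := by
  refine ⟨isPositiveFunctional_integralFunctional, fun x y hx hy h => ?_⟩
  rw [integralFunctional_eq x hx, integralFunctional_eq y hy]
  congr 1
  exact setLIntegral_congr_fun measurableSet_Ioc fun t ht => h t ht.1.le

theorem isFullySymmetricFunctional_integralFunctional :
    IsFullySymmetricFunctional (integralFunctional hM) := by
  refine ⟨isPositiveFunctional_integralFunctional, fun x y hx hy h => ?_⟩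
  rw [integralFunctional_eq x hx, integralFunctional_eq y hy]
  refine ENNReal.toReal_mono ?_ (h 1 zero_le_one)
  rw [lintegral_rearrangement]
  exact (integrable_of_luxemburgSet_nonempty hM x.2).2.ne

theorem isNormalFunctional_integralFunctional :
    IsNormalFunctional (integralFunctional hM) := by
  intro u hu hlim
  have hanti : ∀ᵐ t ∂unitMeasure, Antitone fun n => (u n : L0) t := by
    have : ∀ᵐ t ∂unitMeasure, ∀ n, (u (n + 1) : L0) t ≤ (u n : L0) t :=
      ae_all_iff.2 fun n => AEEqFun.coeFn_le.2 (hu n.le_succ)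
    filter_upwards [this] with t ht using antitone_nat_of_succ_le ht
  have := integral_tendsto_of_tendsto_of_antitone
    (fun n => integrable_of_luxemburgSet_nonempty hM (u n).2)
    (integrable_zero ℝ ℝ unitMeasure) hanti hlim
  simpa [integralFunctional_apply] using this

theorem IsPositiveFunctional.mono {f : StrongDual ℝ (orliczSpace hM)}
    (hf : IsPositiveFunctional f) {x y : orliczSpace hM}
    (h : ∀ᵐ t ∂unitMeasure, (x : L0) t ≤ (y : L0) t) : f x ≤ f y := by
  rw [← sub_nonneg, ← map_sub]
  refine hf _ (L0.nonneg_of_ae ?_)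
  filter_upwards [h, AEEqFun.coeFn_sub (y : L0) (x : L0)] with t ht h'
  rw [Submodule.coe_sub, h']
  exact sub_nonneg.2 ht

/-- Write `x = |x| - (|x| - x)`, a difference of two positive elements of `L_M`. -/
theorem eq_zero_of_forall_nonneg {f : StrongDual ℝ (orliczSpace hM)}
    (hf : ∀ x : orliczSpace hM, 0 ≤ (x : L0) → f x = 0) : f = 0 := by
  ext x
  have hmem : ∀ z : L0, (luxemburgSet M z).Nonempty → (luxemburgSet M |z|).Nonempty :=
    fun z hz => luxemburgSet_nonempty_of_abs_le hM hz <| by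
      filter_upwards [AEEqFun.coeFn_abs z] with t ht
      rw [ht, abs_abs]
  set a : orliczSpace hM := ⟨|(x : L0)|, hmem _ x.2⟩
  have ha : 0 ≤ (a : L0) := L0.nonneg_of_ae <| by
    filter_upwards [AEEqFun.coeFn_abs (x : L0)] with t ht
    rw [ht]; exact abs_nonneg _
  have hax : 0 ≤ ((a - x : orliczSpace hM) : L0) := L0.nonneg_of_ae <| by
    filter_upwards [AEEqFun.coeFn_abs (x : L0), AEEqFun.coeFn_sub (a : L0) (x : L0)] with t ht h'
    rw [Submodule.coe_sub, h', Pi.sub_apply, ht]; exact sub_nonneg.2 (le_abs_self _)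
  have h1 := hf _ hax
  rw [map_sub, hf a ha] at h1
  simpa using h1

end IntegralFunctional
-- Translated pieces and staircases on a grid.
section Translates

/-- The restriction of `z` to `(0,1/n]`, translated to `(j/n,(j+1)/n]`. -/
noncomputable def translatedPiece (z : ℝ → ℝ) (n j : ℕ) (t : ℝ) : ℝ :=
  (Ioc (0 : ℝ) (1 / n)).indicator z (t - j / n)

theorem sub_div_mem_Ioc_iff {n : ℕ} (hn : 0 < n) (j : ℕ) (t : ℝ) :
    t - j / n ∈ Ioc (0 : ℝ) (1 / n) ↔ (j : ℝ) < t * n ∧ t * n ≤ j + 1 := by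
  have hn' : (0 : ℝ) < n := by exact_mod_cast hn
  rw [mem_Ioc, sub_pos, div_lt_iff₀ hn', sub_le_iff_le_add, ← add_div, le_div_iff₀ hn', add_comm]

theorem exists_cell {n : ℕ} (hn : 0 < n) {t : ℝ} (ht : t ∈ Ioc (0 : ℝ) 1) :
    ∃ j < n, t - j / n ∈ Ioc (0 : ℝ) (1 / n) ∧
      ∀ k : ℕ, k ≠ j → t - k / n ∉ Ioc (0 : ℝ) (1 / n) := by
  have hn' : (0 : ℝ) < n := by exact_mod_cast hn
  have hpos : 0 < t * n := mul_pos ht.1 hn'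
  have hle : t * n ≤ n := mul_le_of_le_one_left hn'.le ht.2
  -- Cells are open on the left and closed on the right, so the unique cell containing `t` has index
  -- `⌈t * n⌉ - 1`.
  obtain ⟨j, hj⟩ : ∃ j, ⌈t * n⌉₊ = j + 1 := Nat.exists_eq_succ_of_ne_zero (Nat.ceil_pos.2 hpos).ne'
  have h1 : (j : ℝ) < t * n := Nat.lt_ceil.1 (by omega)
  have h2 : t * n ≤ j + 1 := by exact_mod_cast Nat.ceil_le.1 hj.le
  refine ⟨j, by exact_mod_cast h1.trans_le hle, (sub_div_mem_Ioc_iff hn j t).2 ⟨h1, h2⟩, ?_⟩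
  intro k hk hmem
  obtain ⟨h3, h4⟩ := (sub_div_mem_Ioc_iff hn k t).1 hmem
  have h5 : (k : ℝ) < j + 1 := h3.trans_le h2
  have h6 : (j : ℝ) < k + 1 := h1.trans_le h4
  norm_cast at h5 h6
  omega

theorem translatedPiece_of_mem {z : ℝ → ℝ} {n j : ℕ} {t : ℝ}
    (h : t - j / n ∈ Ioc (0 : ℝ) (1 / n)) : translatedPiece z n j t = z (t - j / n) :=
  indicator_of_mem h _

theorem translatedPiece_of_notMem {z : ℝ → ℝ} {n j : ℕ} {t : ℝ}
    (h : t - j / n ∉ Ioc (0 : ℝ) (1 / n)) : translatedPiece z n j t = 0 :=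
  indicator_of_notMem h _

theorem translatedPiece_nonneg {z : ℝ → ℝ} (hz : ∀ t, 0 ≤ z t) (n j : ℕ) (t : ℝ) :
    0 ≤ translatedPiece z n j t := indicator_nonneg (fun _ _ => hz _) _

theorem measurable_translatedPiece {z : ℝ → ℝ} (hz : Measurable z) (n j : ℕ) :
    Measurable (translatedPiece z n j) :=
  (hz.indicator measurableSet_Ioc).comp (measurable_id.sub_const _)

theorem comp_translatedPiece {F : ℝ → ℝ≥0∞} (hF0 : F 0 = 0) (z : ℝ → ℝ) (n j : ℕ) (t : ℝ) :
    F (translatedPiece z n j t) = (Ioc (0 : ℝ) (1 / n)).indicator (fun s => F (z s)) (t - j / n) := by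
  unfold translatedPiece
  by_cases h : t - j / n ∈ Ioc (0 : ℝ) (1 / n)
  · rw [indicator_of_mem h, indicator_of_mem h]
  · rw [indicator_of_notMem h, indicator_of_notMem h, hF0]

/-- Since `F 0 = 0` and the cell lies in `(0,1]`, the integral extends to the whole line, where
Lebesgue measure is translation invariant. -/
theorem lintegral_translatedPiece {F : ℝ → ℝ≥0∞} (hF0 : F 0 = 0)
    (z : ℝ → ℝ) {n j : ℕ} (hj : j < n) :
    ∫⁻ t, F (translatedPiece z n j t) ∂unitMeasure = ∫⁻ t in Ioc (0 : ℝ) (1 / n), F (z t) := by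
  have hn' : (0 : ℝ) < n := by exact_mod_cast (Nat.zero_le j).trans_lt hj
  have hjn : (j : ℝ) + 1 ≤ n := by exact_mod_cast hj
  have hsupp : Function.support (fun t => F (translatedPiece z n j t)) ⊆ Ioc 0 1 := by
    intro t ht
    by_contra hout
    refine ht ?_
    have : t - j / n ∉ Ioc (0 : ℝ) (1 / n) := fun hmem => by
      obtain ⟨h1, h2⟩ := (sub_div_mem_Ioc_iff (by exact_mod_cast hn') j t).1 hmem
      refine hout ⟨?_, ?_⟩
      · exact pos_of_mul_pos_left ((Nat.cast_nonneg j).trans_lt h1) hn'.le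
      · exact le_of_mul_le_mul_right ((h2.trans hjn).trans_eq (one_mul _).symm) hn'
    simp only [translatedPiece_of_notMem this, hF0]
  rw [unitMeasure, restrict_Ioo_eq_restrict_Ioc, setLIntegral_eq_of_support_subset hsupp]
  simp only [comp_translatedPiece hF0]
  rw [lintegral_sub_right_eq_self (fun s => (Ioc (0 : ℝ) (1 / n)).indicator (fun s => F (z s)) s),
    lintegral_indicator measurableSet_Ioc]

/-- The cells are disjoint, so at each point at most one summand is nonzero. -/
theorem comp_sum_translatedPiece {F : ℝ → ℝ≥0∞} (hF0 : F 0 = 0) (z : ℝ → ℝ) {n : ℕ} (hn : 0 < n)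
    {t : ℝ} (ht : t ∈ Ioc (0 : ℝ) 1) :
    F (∑ j ∈ Finset.range n, translatedPiece z n j t)
      = ∑ j ∈ Finset.range n, F (translatedPiece z n j t) := by
  obtain ⟨j, hj, -, hne⟩ := exists_cell hn ht
  rw [Finset.sum_eq_single_of_mem j (Finset.mem_range.2 hj)
      fun k _ hk => translatedPiece_of_notMem (hne k hk),
    Finset.sum_eq_single_of_mem j (Finset.mem_range.2 hj)
      fun k _ hk => by rw [translatedPiece_of_notMem (hne k hk), hF0]]

/-- Lower staircase: on cell `j` a decreasing `q` is at least its value at the right endpoint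
`(j+1)/(N+1)`. On the last cell, left out of the sum, `q ≥ 0` suffices. -/
theorem sum_mul_translatedPiece_le {q : ℝ → ℝ} (hq : AntitoneOn q (Ioi 0)) (hq0 : ∀ t, 0 ≤ q t)
    (N : ℕ) {t : ℝ} (ht : t ∈ Ioc (0 : ℝ) 1) :
    ∑ j ∈ Finset.range N, q ((j + 1) / (N + 1)) * translatedPiece 1 (N + 1) j t ≤ q t := by
  obtain ⟨j, -, hmem, hne⟩ := exists_cell N.succ_pos ht
  by_cases hj : j ∈ Finset.range N
  · rw [Finset.sum_eq_single_of_mem j hj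
      fun k _ hk => by rw [translatedPiece_of_notMem (hne k hk), mul_zero],
      translatedPiece_of_mem hmem, Pi.one_apply, mul_one]
    have h := ((sub_div_mem_Ioc_iff N.succ_pos j t).1 hmem).2
    push_cast at h
    refine hq ht.1 (mem_Ioi.2 (by positivity)) ?_
    rwa [le_div_iff₀ (by positivity)]
  · rw [Finset.sum_eq_zero]
    · exact hq0 t
    · intro k hk
      rw [translatedPiece_of_notMem (hne k fun h => hj (h ▸ hk)), mul_zero]

/-- Upper staircase: on cell `j + 1`, `q` is at most its value at the left endpoint `(j+1)/(N+1)`.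
On cell `0` it may be unbounded and is kept whole. The heights are those of the lower staircase,
moved one cell to the right. -/
theorem le_add_sum_mul_translatedPiece {q : ℝ → ℝ} (hq : AntitoneOn q (Ioi 0))
    (hq0 : ∀ t, 0 ≤ q t) (N : ℕ) {t : ℝ} (ht : t ∈ Ioc (0 : ℝ) 1) :
    q t ≤ translatedPiece q (N + 1) 0 t +
      ∑ j ∈ Finset.range N, q ((j + 1) / (N + 1)) * translatedPiece 1 (N + 1) (j + 1) t := by
  have hterm : ∀ j ∈ Finset.range N,
      0 ≤ q ((j + 1) / (N + 1)) * translatedPiece 1 (N + 1) (j + 1) t := fun j _ =>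
    mul_nonneg (hq0 _) (translatedPiece_nonneg (fun _ => zero_le_one) _ _ _)
  obtain ⟨j, hj, hmem, -⟩ := exists_cell N.succ_pos ht
  rcases j with _ | j
  · have : translatedPiece q (N + 1) 0 t = q t := by
      rw [translatedPiece_of_mem hmem]; simp
    rw [this]
    exact le_add_of_nonneg_right (Finset.sum_nonneg hterm)
  · have h := ((sub_div_mem_Ioc_iff N.succ_pos (j + 1) t).1 hmem).1
    push_cast at h
    have hle : q t ≤ q ((j + 1) / (N + 1)) * translatedPiece 1 (N + 1) (j + 1) t := by
      rw [translatedPiece_of_mem hmem, Pi.one_apply, mul_one]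
      refine hq (mem_Ioi.2 (by positivity)) ht.1 ?_
      rw [div_le_iff₀ (by positivity)]
      exact h.le
    refine (hle.trans (Finset.single_le_sum hterm (Finset.mem_range.2 (by omega)))).trans ?_
    exact le_add_of_nonneg_left (translatedPiece_nonneg hq0 _ _ _)

end Translates

/-! ### Pieces as elements of `L_M`, and the growth of dilations. -/

section PiecesInOrliczSpace

theorem ae_mem_Ioc : ∀ᵐ t ∂unitMeasure, t ∈ Ioc (0 : ℝ) 1 := by
  filter_upwards [ae_restrict_mem measurableSet_Ioo] with t ht using ⟨ht.1, ht.2.le⟩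

/-- `translatedPiece z n j` as an element of `L₀`. -/
noncomputable def pieceL0 {z : ℝ → ℝ} (hz : Measurable z) (n j : ℕ) : L0 :=
  AEEqFun.mk (translatedPiece z n j) (measurable_translatedPiece hz n j).aestronglyMeasurable

theorem coeFn_pieceL0 {z : ℝ → ℝ} (hz : Measurable z) (n j : ℕ) :
    pieceL0 hz n j =ᵐ[unitMeasure] translatedPiece z n j := AEEqFun.coeFn_mk _ _

theorem lintegral_pieceL0 {F : ℝ → ℝ≥0∞} (hF0 : F 0 = 0) {z : ℝ → ℝ}
    (hz : Measurable z) {n j : ℕ} (hj : j < n) :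
    ∫⁻ t, F (pieceL0 hz n j t) ∂unitMeasure = ∫⁻ t in Ioc (0 : ℝ) (1 / n), F (z t) := by
  rw [← lintegral_translatedPiece hF0 z hj]
  refine lintegral_congr_ae ?_
  filter_upwards [coeFn_pieceL0 hz n j] with t ht
  rw [ht]

theorem sameLaw_pieceL0 {z : ℝ → ℝ} (hz : Measurable z) {n j k : ℕ} (hj : j < n) (hk : k < n) :
    SameLaw (pieceL0 hz n j) (pieceL0 hz n k) := fun _ _ hF0 => by
  rw [lintegral_pieceL0 hF0 hz hj, lintegral_pieceL0 hF0 hz hk]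

variable {M : ℝ → ℝ} {hM : IsOrliczFunction M}

/-- Piece `0` is dominated by `|x|`, and every other piece has the same law as piece `0`. -/
theorem luxemburgSet_pieceL0_nonempty (hM : IsOrliczFunction M) {z : ℝ → ℝ} (hz : Measurable z)
    {x : L0} (hx : (luxemburgSet M x).Nonempty) (hxz : x =ᵐ[unitMeasure] z) {n j : ℕ}
    (hj : j < n) : (luxemburgSet M (pieceL0 hz n j)).Nonempty := by
  refine (sameLaw_pieceL0 hz hj ((Nat.zero_le j).trans_lt hj)).luxemburgSet_nonempty hM
    (luxemburgSet_nonempty_of_abs_le hM hx ?_)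
  filter_upwards [coeFn_pieceL0 hz n 0, hxz] with t h1 h2
  rw [h1, h2]
  by_cases h : t - (0 : ℕ) / n ∈ Ioc (0 : ℝ) (1 / n)
  · rw [translatedPiece_of_mem h]; simp
  · rw [translatedPiece_of_notMem h, abs_zero]; exact abs_nonneg _

/-- The pieces of `z` as elements of `L_M` (and `0` for `j ≥ n`). -/
noncomputable def piece (hM : IsOrliczFunction M) {z : ℝ → ℝ} (hz : Measurable z)
    {x : orliczSpace hM} (hxz : (x : L0) =ᵐ[unitMeasure] z) (n j : ℕ) : orliczSpace hM :=
  if hj : j < n then ⟨pieceL0 hz n j, luxemburgSet_pieceL0_nonempty hM hz x.2 hxz hj⟩ else 0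

variable {z : ℝ → ℝ} (hz : Measurable z) {x : orliczSpace hM}
  (hxz : (x : L0) =ᵐ[unitMeasure] z)

theorem coe_piece {n j : ℕ} (hj : j < n) : (piece hM hz hxz n j : L0) = pieceL0 hz n j := by
  rw [piece, dif_pos hj]

theorem ae_forall_piece (n : ℕ) : ∀ᵐ t ∂unitMeasure, ∀ j < n,
    (piece hM hz hxz n j : L0) t = translatedPiece z n j t := by
  refine ae_all_iff.2 fun j => ?_
  by_cases hj : j < n
  · filter_upwards [coeFn_pieceL0 hz n j] with t ht _
    rw [coe_piece hz hxz hj, ht]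
  · exact Eventually.of_forall fun t h => absurd h hj

theorem ae_sum_piece (n : ℕ) : ∀ᵐ t ∂unitMeasure,
    ((∑ j ∈ Finset.range n, piece hM hz hxz n j : orliczSpace hM) : L0) t
      = ∑ j ∈ Finset.range n, translatedPiece z n j t := by
  rw [Submodule.coe_sum]
  filter_upwards [ae_forall_piece hz hxz n,
    AEEqFun.coeFn_fun_finsetSum (μ := unitMeasure) (Finset.range n)
      fun j => (piece hM hz hxz n j : L0)] with t h1 h2
  rw [h2]
  exact Finset.sum_congr rfl fun j hj => h1 j (Finset.mem_range.1 hj)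

theorem IsSymmetricFunctional.map_piece {f : StrongDual ℝ (orliczSpace hM)}
    (hf : IsSymmetricFunctional f) (hz0 : ∀ t, 0 ≤ z t) {n j : ℕ} (hj : j < n) :
    f (piece hM hz hxz n j) = f (piece hM hz hxz n 0) := by
  have h0 : 0 < n := (Nat.zero_le j).trans_lt hj
  have hnn : ∀ k, 0 ≤ pieceL0 hz n k := fun k => L0.nonneg_of_ae <| by
    filter_upwards [coeFn_pieceL0 hz n k] with t ht
    rw [ht]; exact translatedPiece_nonneg hz0 _ _ _
  refine hf.2 _ _ ?_ ?_ ?_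
  · rw [coe_piece hz hxz h0]; exact hnn _
  · rw [coe_piece hz hxz hj]; exact hnn _
  · rw [coe_piece hz hxz h0, coe_piece hz hxz hj]
    exact (sameLaw_pieceL0 hz hj h0).equimeasurable

theorem IsSymmetricFunctional.map_sum_piece {f : StrongDual ℝ (orliczSpace hM)}
    (hf : IsSymmetricFunctional f) (hz0 : ∀ t, 0 ≤ z t) (n : ℕ) :
    f (∑ j ∈ Finset.range n, piece hM hz hxz n j) = n * f (piece hM hz hxz n 0) := by
  rw [map_sum, Finset.sum_congr rfl fun j hj =>
    hf.map_piece hz hxz hz0 (Finset.mem_range.1 hj)]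
  simp

theorem orliczModular_sum_piece {n : ℕ} (hn : 0 < n) {lam : ℝ} (hl : 0 < lam) :
    orliczModular M (∑ j ∈ Finset.range n, piece hM hz hxz n j : orliczSpace hM) lam
      = n * ∫⁻ t in Ioc (0 : ℝ) (1 / n), ENNReal.ofReal (M (|z t| / lam)) := by
  set F : ℝ → ℝ≥0∞ := fun s => ENNReal.ofReal (M (|s| / lam)) with hF
  have hF0 : F 0 = 0 := by simp [hF, hM.map_zero]
  have hFm : Measurable F := hM.measurable_modular hl
  calc orliczModular M (∑ j ∈ Finset.range n, piece hM hz hxz n j : orliczSpace hM) lam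
      = ∫⁻ t, ∑ j ∈ Finset.range n, F (translatedPiece z n j t) ∂unitMeasure := by
        refine lintegral_congr_ae ?_
        filter_upwards [ae_sum_piece hz hxz n, ae_mem_Ioc] with t h1 h2
        rw [← comp_sum_translatedPiece hF0 z hn h2, h1]
    _ = ∑ j ∈ Finset.range n, ∫⁻ t in Ioc (0 : ℝ) (1 / n), F (z t) := by
        rw [lintegral_finsetSum (f := fun j t => F (translatedPiece z n j t)) _
          fun j _ => hFm.comp (measurable_translatedPiece hz n j)]
        exact Finset.sum_congr rfl fun j hj =>
          lintegral_translatedPiece hF0 z (Finset.mem_range.1 hj)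
    _ = _ := by simp [hF]

/-- The dilations `σₙ x` satisfy `‖σₙ x‖ / n → 0`. -/
theorem eventually_norm_sum_piece_le {ε : ℝ} (hε : 0 < ε) : ∀ᶠ n : ℕ in atTop,
    ‖∑ j ∈ Finset.range n, piece hM hz hxz n j‖ ≤ n * ε := by
  obtain ⟨a, ha, ha1⟩ := x.2
  have hmod : ∫⁻ t in Ioc (0 : ℝ) 1, ENNReal.ofReal (M (|z t| / a)) ≤ 1 := by
    rw [← restrict_Ioo_eq_restrict_Ioc]
    refine le_of_eq_of_le (lintegral_congr_ae ?_) ha1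
    filter_upwards [hxz] with t ht
    rw [ht]
  -- Absolute continuity of the integral of `M(|z|/a)`, which is finite because `a` is admissible
  -- for `x`.
  have hlim : Tendsto (fun n : ℕ => ∫⁻ t in Ioc (0 : ℝ) (1 / n), ENNReal.ofReal (M (|z t| / a))
      ∂volume.restrict (Ioc (0 : ℝ) 1)) atTop (𝓝 0) := by
    refine tendsto_setLIntegral_zero (hmod.trans_lt ENNReal.one_lt_top).ne ?_
    have h0 : Tendsto (fun n : ℕ => ENNReal.ofReal (1 / (n : ℝ))) atTop (𝓝 0) := by
      simpa using ENNReal.tendsto_ofReal tendsto_one_div_atTop_nhds_zero_nat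
    refine tendsto_of_tendsto_of_tendsto_of_le_of_le tendsto_const_nhds h0 (fun _ => zero_le)
      fun n => ?_
    refine (Measure.restrict_apply_le _ _).trans ?_
    simp
  -- The threshold is chosen so that `n * (a / (n * ε)) * (ε / a) = 1`: the convexity factor `a / (n
  -- * ε)` absorbs the `n` copies.
  have hea : 0 < ε / a := by positivity
  filter_upwards [hlim.eventually (gt_mem_nhds (ENNReal.ofReal_pos.2 hea)),
    eventually_gt_atTop 0, (tendsto_natCast_atTop_atTop (R := ℝ)).eventually_ge_atTop (a / ε)]
    with n hn hn0 hna
  have hn' : (0 : ℝ) < n := by exact_mod_cast hn0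
  have hn1 : (1 : ℝ) ≤ n := by exact_mod_cast hn0
  rw [Measure.restrict_restrict measurableSet_Ioc,
    inter_eq_left.2 (Ioc_subset_Ioc_right ((div_le_one hn').2 hn1))] at hn
  have hc0 : 0 < a / (n * ε) := by positivity
  have hc1 : a / (n * ε) ≤ 1 := by
    rw [div_le_one (by positivity)]
    exact (div_le_iff₀ hε).1 hna
  refine csInf_le (luxemburgSet_bddBelow M _) ⟨by positivity, ?_⟩
  rw [orliczModular_sum_piece hz hxz hn0 (by positivity)]
  calc (n : ℝ≥0∞) * ∫⁻ t in Ioc (0 : ℝ) (1 / n), ENNReal.ofReal (M (|z t| / (n * ε)))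
      ≤ n * ∫⁻ t in Ioc (0 : ℝ) (1 / n),
          ENNReal.ofReal (a / (n * ε)) * ENNReal.ofReal (M (|z t| / a)) := by
        gcongr with t
        rw [← ENNReal.ofReal_mul hc0.le]
        refine ENNReal.ofReal_le_ofReal ?_
        have := hM.map_mul_le hc0.le hc1 (show 0 ≤ |z t| / a by positivity)
        rwa [mul_comm, div_mul_div_cancel₀ ha.ne'] at this
    _ = n * (ENNReal.ofReal (a / (n * ε)) *
          ∫⁻ t in Ioc (0 : ℝ) (1 / n), ENNReal.ofReal (M (|z t| / a))) := by
        rw [lintegral_const_mul (f := fun t => ENNReal.ofReal (M (|z t| / a))) _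
          ((hM.measurable_modular ha).comp hz)]
    _ ≤ n * (ENNReal.ofReal (a / (n * ε)) * ENNReal.ofReal (ε / a)) := by gcongr
    _ = 1 := by
        rw [← ENNReal.ofReal_mul hc0.le, ← ENNReal.ofReal_natCast n, ← ENNReal.ofReal_mul hn'.le,
          ← ENNReal.ofReal_one]
        congr 1
        field_simp

/-- By symmetry `n * f (head) = f (σₙ x)`, which is at most `‖f‖ * n * δ` for large `n`; divide by
`n`. -/
theorem IsSymmetricFunctional.tendsto_map_piece {f : StrongDual ℝ (orliczSpace hM)}
    (hf : IsSymmetricFunctional f) (hz0 : ∀ t, 0 ≤ z t) :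
    Tendsto (fun n : ℕ => f (piece hM hz hxz n 0)) atTop (𝓝 0) := by
  rw [Metric.tendsto_atTop']
  intro ε hε
  have hδ : 0 < ε / (‖f‖ + 1) := by positivity
  obtain ⟨m, hm⟩ := eventually_atTop.1 (eventually_norm_sum_piece_le hz hxz hδ)
  refine ⟨m, fun n hn => ?_⟩
  have hn' : (0 : ℝ) < n := by exact_mod_cast (Nat.zero_le m).trans_lt hn
  have h1 := (f.le_opNorm _).trans (mul_le_mul_of_nonneg_left (hm n hn.le) (norm_nonneg f))
  rw [hf.map_sum_piece hz hxz hz0, norm_mul, Real.norm_of_nonneg hn'.le,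
    mul_left_comm] at h1
  have h2 := le_of_mul_le_mul_left h1 hn'
  rw [dist_zero_right]
  refine h2.trans_lt ?_
  rw [mul_div_assoc', div_lt_iff₀ (by positivity), mul_comm]
  exact mul_lt_mul_of_pos_left (lt_add_one _) hε

end PiecesInOrliczSpace

/-! ### Symmetric functionals are multiples of the integral. -/

section Main

variable {M : ℝ → ℝ} {hM : IsOrliczFunction M}

noncomputable instance (hM : IsOrliczFunction M) : One (orliczSpace hM) := ⟨⟨1, luxemburgSet_one_nonempty hM⟩⟩

theorem coeFn_one_orliczSpace :
    ((1 : orliczSpace hM) : L0) =ᵐ[unitMeasure] (1 : ℝ → ℝ) := AEEqFun.coeFn_one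

/-- The `n` cell indicators add up to `1`, and `f` takes the same value on each. -/
theorem IsSymmetricFunctional.map_piece_one {f : StrongDual ℝ (orliczSpace hM)}
    (hf : IsSymmetricFunctional f) {n j : ℕ} (hj : j < n) :
    f (piece hM measurable_one coeFn_one_orliczSpace n j) = f 1 / n := by
  have hn : 0 < n := (Nat.zero_le j).trans_lt hj
  have hn' : (0 : ℝ) < n := by exact_mod_cast hn
  have hsum : ∑ j ∈ Finset.range n, piece hM measurable_one coeFn_one_orliczSpace n j = 1 := by
    refine Subtype.ext (AEEqFun.ext ?_)
    filter_upwards [ae_sum_piece (hM := hM) measurable_one coeFn_one_orliczSpace n,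
      coeFn_one_orliczSpace (hM := hM), ae_mem_Ioc] with t h1 h2 h3
    obtain ⟨j, hj, hmem, hne⟩ := exists_cell hn h3
    rw [h1, h2, Finset.sum_eq_single_of_mem j (Finset.mem_range.2 hj)
      fun k _ hk => translatedPiece_of_notMem (hne k hk), translatedPiece_of_mem hmem]
    rfl
  have h := hf.map_sum_piece measurable_one coeFn_one_orliczSpace (fun _ => zero_le_one) n
  rw [hsum] at h
  rw [hf.map_piece measurable_one coeFn_one_orliczSpace (fun _ => zero_le_one) hj, h,
    mul_div_cancel_left₀ _ hn'.ne']

theorem ae_sum_smul_piece (n : ℕ) (s : Finset ℕ) (c : ℕ → ℝ) (g : ℕ → ℕ)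
    (hg : ∀ j ∈ s, g j < n) : ∀ᵐ t ∂unitMeasure,
    ((∑ j ∈ s, c j • piece hM measurable_one coeFn_one_orliczSpace n (g j) :
      orliczSpace hM) : L0) t = ∑ j ∈ s, c j * translatedPiece 1 n (g j) t := by
  rw [Submodule.coe_sum]
  have hsm : ∀ᵐ t ∂unitMeasure, ∀ j,
      ((c j • piece hM measurable_one coeFn_one_orliczSpace n (g j) : orliczSpace hM) : L0) t
        = c j * (piece hM measurable_one coeFn_one_orliczSpace n (g j) : L0) t :=
    ae_all_iff.2 fun j => AEEqFun.coeFn_smul (c j) _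
  filter_upwards [ae_forall_piece (hM := hM) measurable_one coeFn_one_orliczSpace n, hsm,
    AEEqFun.coeFn_fun_finsetSum (μ := unitMeasure) s fun j => ((c j •
      piece hM measurable_one coeFn_one_orliczSpace n (g j) : orliczSpace hM) : L0)]
    with t h1 h2 h3
  rw [h3]
  exact Finset.sum_congr rfl fun j hj => by rw [h2, h1 _ (hg j hj)]

theorem IsSymmetricFunctional.tendsto_sub_riemannSum {f : StrongDual ℝ (orliczSpace hM)}
    (hf : IsSymmetricFunctional f) {q : ℝ → ℝ} (hqm : Measurable q) (hq : AntitoneOn q (Ioi 0))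
    (hq0 : ∀ t, 0 ≤ q t) {x : orliczSpace hM} (hx : (x : L0) =ᵐ[unitMeasure] q) :
    Tendsto (fun N : ℕ => f x - f 1 *
      ((∑ j ∈ Finset.range N, q ((j + 1) / (N + 1))) / (N + 1))) atTop (𝓝 0) := by
  -- The value does not depend on where the steps are placed: `g = id` gives the lower staircase and
  -- `g = (· + 1)` the upper one.
  have hval : ∀ (N : ℕ) (g : ℕ → ℕ), (∀ j ∈ Finset.range N, g j < N + 1) →
      f (∑ j ∈ Finset.range N, q ((j + 1) / (N + 1)) •
        piece hM measurable_one coeFn_one_orliczSpace (N + 1) (g j))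
        = f 1 * ((∑ j ∈ Finset.range N, q ((j + 1) / (N + 1))) / (N + 1)) := by
    intro N g hg
    rw [map_sum, Finset.sum_div, Finset.mul_sum]
    refine Finset.sum_congr rfl fun j hj => ?_
    rw [map_smul, hf.map_piece_one (hg j hj), smul_eq_mul]
    push_cast
    ring
  have hg0 : ∀ N : ℕ, ∀ j ∈ Finset.range N, j < N + 1 := fun N j hj => by
    have := Finset.mem_range.1 hj; omega
  have hg1 : ∀ N : ℕ, ∀ j ∈ Finset.range N, j + 1 < N + 1 := fun N j hj => by
    have := Finset.mem_range.1 hj; omega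
  refine tendsto_of_tendsto_of_tendsto_of_le_of_le tendsto_const_nhds
    ((hf.tendsto_map_piece hqm hx hq0).comp (tendsto_add_atTop_nat 1)) ?_ ?_
  · intro N
    rw [sub_nonneg, ← hval N id (hg0 N)]
    refine hf.1.mono ?_
    filter_upwards [ae_sum_smul_piece (hM := hM) (N + 1) (Finset.range N)
      (fun j => q ((j + 1) / (N + 1))) id (hg0 N), hx, ae_mem_Ioc] with t h1 h2 h3
    rw [h1, h2]
    exact sum_mul_translatedPiece_le hq hq0 N h3
  · intro N
    simp only [Function.comp]
    rw [sub_le_iff_le_add, ← hval N (· + 1) (hg1 N), ← map_add]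
    refine hf.1.mono ?_
    filter_upwards [ae_sum_smul_piece (hM := hM) (N + 1) (Finset.range N)
      (fun j => q ((j + 1) / (N + 1))) (· + 1) (hg1 N), hx, ae_mem_Ioc,
      ae_forall_piece (hM := hM) hqm hx (N + 1), AEEqFun.coeFn_add
        (piece hM hqm hx (N + 1) 0 : L0) ((∑ j ∈ Finset.range N, q ((j + 1) / (N + 1)) •
        piece hM measurable_one coeFn_one_orliczSpace (N + 1) (j + 1) : orliczSpace hM) : L0)]
      with t h1 h2 h3 h4 h5
    rw [Submodule.coe_add, h5, Pi.add_apply, h1, h2, h4 0 N.succ_pos]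
    exact le_add_sum_mul_translatedPiece hq hq0 N h3

/-- The Riemann sums of `x*` do not involve `f`. The integral is itself symmetric with value `1` at
`1`, so subtracting the two limits eliminates these sums, and their convergence need not be known.
-/
theorem IsSymmetricFunctional.eq_mul_integral {f : StrongDual ℝ (orliczSpace hM)}
    (hf : IsSymmetricFunctional f) (x : orliczSpace hM) (hx : 0 ≤ (x : L0)) :
    f x = f 1 * integralFunctional hM x := by
  have hI := isSymmetricFunctional_integralFunctional (hM := hM)
  have hlaw := sameLaw_realRearrangement hx
  set y : orliczSpace hM := ⟨AEEqFun.mk (realRearrangement x)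
    (measurable_realRearrangement x).aestronglyMeasurable, hlaw.luxemburgSet_nonempty hM x.2⟩
  have hyq : (y : L0) =ᵐ[unitMeasure] realRearrangement x := AEEqFun.coeFn_mk _ _
  have hy : 0 ≤ (y : L0) := L0.nonneg_of_ae <| by
    filter_upwards [hyq] with t ht
    rw [ht]; exact realRearrangement_nonneg _ _
  have hI1 : integralFunctional hM 1 = 1 := by
    rw [integralFunctional_apply, integral_congr_ae coeFn_one_orliczSpace]
    simp
  rw [← hf.2 x y hx hy hlaw.equimeasurable, ← hI.2 x y hx hy hlaw.equimeasurable]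
  have h1 := hf.tendsto_sub_riemannSum (measurable_realRearrangement x)
    (realRearrangement_antitoneOn x) (realRearrangement_nonneg x) hyq
  have h2 := (hI.tendsto_sub_riemannSum (measurable_realRearrangement x)
    (realRearrangement_antitoneOn x) (realRearrangement_nonneg x) hyq).const_mul (f 1)
  have h3 := tendsto_nhds_unique (h1.sub h2) (tendsto_const_nhds.congr fun N => by
    rw [hI1]
    show f y - f 1 * integralFunctional hM y = _
    ring)
  linarith

theorem mainTheorem9 (M : ℝ → ℝ) (hM : IsOrliczFunction M) :
    (∀ f : StrongDual ℝ (orliczSpace hM),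
      IsSymmetricFunctional f → IsFullySymmetricFunctional f) ∧
    (∀ f : StrongDual ℝ (orliczSpace hM),
      IsSymmetricFunctional f → IsSingularFunctional f → f = 0) := by
  have hone : 0 ≤ ((1 : orliczSpace hM) : L0) := L0.nonneg_of_ae <| by
    filter_upwards [coeFn_one_orliczSpace (hM := hM)] with t ht
    rw [ht]; exact zero_le_one
  refine ⟨fun f hf => ⟨hf.1, fun x y hx hy h => ?_⟩, fun f hf hs => ?_⟩
  · rw [hf.eq_mul_integral x hx, hf.eq_mul_integral y hy]
    exact mul_le_mul_of_nonneg_left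
      (isFullySymmetricFunctional_integralFunctional.2 x y hx hy h) (hf.1 1 hone)
  -- The multiple `f 1 • ∫` is positive and normal and agrees with `f` on the positive cone, so
  -- singularity of `f` applies to it.
  · have hg : f 1 • integralFunctional hM = 0 := by
      refine hs _ (fun x hx => ?_) (fun u hu hlim => ?_) fun x hx => ?_
      · exact mul_nonneg (hf.1 1 hone) (isPositiveFunctional_integralFunctional x hx)
      · simpa using (isNormalFunctional_integralFunctional u hu hlim).const_mul (f 1)
      · rw [sub_apply, smul_apply, smul_eq_mul,
          ← hf.eq_mul_integral x hx, sub_self]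
    refine eq_zero_of_forall_nonneg fun x hx => ?_
    rw [hf.eq_mul_integral x hx]
    exact congrArg (fun g : StrongDual ℝ (orliczSpace hM) => g x) hg

end Main
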